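/- **Setting.** Let $0<\lambda=\lambda_1\le\lambda_2\le\dots\le\lambda_N$, let $\boldsymbol\Lambda=\mathrm{diag}(\lambda_1,\dots,\lambda_N)$ (for spectral bandits, $\boldsymbol\Lambda=\boldsymbol\Lambda_{\mathcal L}+\lambda\mathbf I$ with $\boldsymbol\Lambda_{\mathcal L}$ the ordered eigenvalues of a graph Laplacian and $\lambda>0$ a regularizer), and write $\|v\|_M=\sqrt{v^{\mathsf T}Mv}$. There are $K\ge 1$ arms with feature vectors $\mathbf x_1,\dots,\mathbf x_K\in\mathbb R^N$, $\|\mathbf x_a\|_2\le 1$, and an unknown parameter $\boldsymbol\alpha\in\mathbb R^N$. In round $t=1,\dots,T$ ($T\ge1$) the learner plays an arm $I_t$ and observes the reward $r_t=\langle \mathbf x_{I_t},\boldsymbol\alpha\rangle+\varepsilon_t$, where the noise is adapted to a filtration $(\mathcal F_t)_{t\ge 0}$ and is conditionally $R$-sub-Gaussian ($R\ge 0$): $\mathbb E[e^{s\varepsilon_t}\mid\mathcal F_{t-1}]\le e^{s^2R^2/2}$ almost surely for all $s\in\mathbb R$. The cumulative regret is $R_T=T\max_a\langle \mathbf x_a,\boldsymbol\alpha\rangle-\sum_{t=1}^T\langle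 \mathbf x_{I_t},\boldsymbol\alpha\rangle$. The effective dimension $d$ is the largest $d\in\{1,\dots,N\}$ with $(d-1)\lambda_d\le T/\log(1+T/\lambda)$. **Algorithm (SpectralEliminator)** with parameter $\beta$ and phase starts $t_1=1\le t_2\le\cdots$. Start with all arms active, $A_1=\{1,\dots,K\}$. Phase $j$ consists of the rounds $t_j\le t<t_{j+1}$, $t\le T$. Set $\mathbf V_{t_j}=\boldsymbol\Lambda$; in each round $t$ of the phase play an arm $I_t\in A_j$ maximizing the width $\|\mathbf x_a\|_{\mathbf V_t^{-1}}$ over $a\in A_j$ (ties are broken by a fixed deterministic rule, a function of the round and of the set of maximizers) and set $\mathbf V_{t+1}=\mathbf V_t+\mathbf x_{I_t}\mathbf x_{I_t}^{\mathsf T}$. At the end of the phase let $\mathbf V=\mathbf V_{t_{j+1}}$ and $\widehat{\boldsymbol\alpha}=\mathbf V^{-1}\sum_{s=t_j}^{t_{j+1}-1}r_s\mathbf x_{I_s}$, and keep $$A_{j+1}=\Big\{a\in A_j:\ \langle\widehat{\boldsymbol\alpha},\mathbf x_a\rangle+\beta\|\mathbf x_a\|_{\mathbf V^{-1}}\ \ge\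 \max_{b\in A_j}\big(\langle\widehat{\boldsymbol\alpha},\mathbf x_b\rangle-\beta\|\mathbf x_b\|_{\mathbf V^{-1}}\big)\Big\}.$$ **Theorem (Regret of SpectralEliminator).** Choose the phase starts $t_j=2^{j-1}$. Assume that all expected rewards $\langle \mathbf x_a,\boldsymbol\alpha\rangle$ are in $[0,1]$ and that $\|\boldsymbol\alpha\|_{\boldsymbol\Lambda}\le C$. For any $\delta>0$, with probability at least $1-\delta$, the cumulative regret of SpectralEliminator run with parameter $\beta=2R\sqrt{14\log\big(2K(1+\log_2T)/\delta\big)}+C$ is bounded as $$R_T\le 2+16\left(2R\sqrt{14\log\frac{2K(1+\log_2T)}{\delta}}+C+\frac12\right)\sqrt{d\,T\log_2(T)\,\log\left(1+T/\lambda\right)}.$$ (If $\delta\geq 1$ there is nothing to prove; a square root of a negative number is read as $0$ there.) -/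

import Mathlib

open MeasureTheory ProbabilityTheory
open scoped Matrix

/-- The weighted (semi)norm `‖v‖_M = √(vᵀ M v)`. -/
noncomputable def weightedNorm {N : ℕ} (M : Matrix (Fin N) (Fin N) ℝ) (v : Fin N → ℝ) : ℝ :=
  √(v ⬝ᵥ M *ᵥ v)

/-- The effective dimension: the largest `d ∈ {1, …, N}` with
`(d - 1) λ_d ≤ T / log (1 + T / λ)`, where `λ = λ_1`.
The entry `lam i` is `λ_{i+1}`, so that the index `i` corresponds to `d = i + 1`. -/
noncomputable def effectiveDim {N : ℕ} [NeZero N] (lam : Fin N → ℝ) (T : ℕ) : ℕ :=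
  (Finset.univ.filter fun i : Fin N =>
    (i : ℝ) * lam i ≤ (T : ℝ) / Real.log (1 + (T : ℝ) / lam 0)).sup fun i => (i : ℕ) + 1

/-! ### The algorithm SpectralEliminator

Arms are indexed by `Fin K`, with feature vectors `x a`; `Lam` is the spectral penalty matrix,
`β` the confidence parameter, `τ j` the first round of phase `j` (`j = 1, 2, …`), and
`tie t S` is the element of `S` that is picked at round `t` when `S` is the set of maximizers. -/

/-- The arms of `A` with the largest width `‖x‖_{V⁻¹}`. -/
noncomputable def widestArms {K N : ℕ} (x : Fin K → Fin N → ℝ) (A : Finset (Fin K))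
    (V : Matrix (Fin N) (Fin N) ℝ) : Finset (Fin K) :=
  A.filter fun a => ∀ a' ∈ A, weightedNorm V⁻¹ (x a') ≤ weightedNorm V⁻¹ (x a)

/-- The regularized covariance matrix after `k` rounds of a phase that starts at round `t₀`
with active set `A`: it starts at `Lam`, and each round adds `x xᵀ` for the arm `x` played,
an arm of `A` of largest width. -/
noncomputable def phaseCov {K N : ℕ} (x : Fin K → Fin N → ℝ) (Lam : Matrix (Fin N) (Fin N) ℝ)
    (tie : ℕ → Finset (Fin K) → Fin K) (A : Finset (Fin K)) (t₀ : ℕ) :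
    ℕ → Matrix (Fin N) (Fin N) ℝ
  | 0 => Lam
  | k + 1 =>
      let V := phaseCov x Lam tie A t₀ k
      let a := tie (t₀ + k) (widestArms x A V)
      V + Matrix.vecMulVec (x a) (x a)

/-- The arm played at round `t₀ + k` of a phase that starts at round `t₀` with active set `A`. -/
noncomputable def phaseArm {K N : ℕ} (x : Fin K → Fin N → ℝ) (Lam : Matrix (Fin N) (Fin N) ℝ)
    (tie : ℕ → Finset (Fin K) → Fin K) (A : Finset (Fin K)) (t₀ k : ℕ) : Fin K :=
  tie (t₀ + k) (widestArms x A (phaseCov x Lam tie A t₀ k))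

/-- The regularized least-squares estimate from the `n` rounds of a phase that starts at round
`t₀` with active set `A`, where `r t` is the reward observed at round `t`. -/
noncomputable def phaseEstimate {K N : ℕ} (x : Fin K → Fin N → ℝ)
    (Lam : Matrix (Fin N) (Fin N) ℝ) (tie : ℕ → Finset (Fin K) → Fin K) (r : ℕ → ℝ)
    (A : Finset (Fin K)) (t₀ n : ℕ) : Fin N → ℝ :=
  (phaseCov x Lam tie A t₀ n)⁻¹ *ᵥ
    ∑ k ∈ Finset.range n, r (t₀ + k) • x (phaseArm x Lam tie A t₀ k)

/-- The elimination step: keep the arms whose upper confidence bound is at least the largest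
lower confidence bound over `A`. -/
noncomputable def eliminate {K N : ℕ} (x : Fin K → Fin N → ℝ) (β : ℝ) (A : Finset (Fin K))
    (V : Matrix (Fin N) (Fin N) ℝ) (est : Fin N → ℝ) : Finset (Fin K) :=
  A.filter fun a => ∀ a' ∈ A,
    est ⬝ᵥ x a' - β * weightedNorm V⁻¹ (x a') ≤ est ⬝ᵥ x a + β * weightedNorm V⁻¹ (x a)

/-- The set `A_j` of arms that are active in phase `j ≥ 1`, as a function of the rewards
observed in the earlier phases. (The value at `j = 0` is not used.) -/
noncomputable def activeArms {K N : ℕ} (x : Fin K → Fin N → ℝ) (Lam : Matrix (Fin N) (Fin N) ℝ)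
    (β : ℝ) (τ : ℕ → ℕ) (tie : ℕ → Finset (Fin K) → Fin K) (r : ℕ → ℝ) : ℕ → Finset (Fin K)
  | 0 => Finset.univ
  | 1 => Finset.univ
  | j + 2 =>
      let A := activeArms x Lam β τ tie r (j + 1)
      let t₀ := τ (j + 1)
      let n := τ (j + 2) - τ (j + 1)
      eliminate x β A (phaseCov x Lam tie A t₀ n) (phaseEstimate x Lam tie r A t₀ n)

/-- During the rounds `1, …, T`, the arms `I t` are those that SpectralEliminator plays when
the observed rewards are `r t`. -/
def IsSpectralEliminatorRun {K N : ℕ} (x : Fin K → Fin N → ℝ) (Lam : Matrix (Fin N) (Fin N) ℝ)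
    (β : ℝ) (τ : ℕ → ℕ) (tie : ℕ → Finset (Fin K) → Fin K) (T : ℕ)
    (I : ℕ → Fin K) (r : ℕ → ℝ) : Prop :=
  ∀ j, 1 ≤ j → ∀ t, τ j ≤ t → t < τ (j + 1) → t ≤ T →
    I t = phaseArm x Lam tie (activeArms x Lam β τ tie r j) (τ j) (t - τ j)

/-! ### Noise and regret -/

/-- The noise variables `ε 1, …, ε T` are adapted to the filtration `ℱ`, and each is
`R`-sub-Gaussian conditionally on the past. -/
def IsSubGaussianNoise {Ω : Type*} {mΩ : MeasurableSpace Ω} (μ : Measure Ω)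
    (ℱ : Filtration ℕ mΩ) (R : ℝ) (T : ℕ) (ε : ℕ → Ω → ℝ) : Prop :=
  ∀ t < T, Measurable[ℱ (t + 1)] (ε (t + 1)) ∧
    ∀ s : ℝ, Integrable (fun ω => Real.exp (s * ε (t + 1) ω)) μ ∧
      μ[fun ω => Real.exp (s * ε (t + 1) ω) | ℱ t] ≤ᵐ[μ] fun _ => Real.exp (s ^ 2 * R ^ 2 / 2)

/-- The cumulative pseudo-regret `T max_a ⟨x_a, α⟩ - ∑_{t = 1}^T ⟨x_{I_t}, α⟩`. -/
noncomputable def cumulativeRegret {K N : ℕ} [NeZero K] (x : Fin K → Fin N → ℝ)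
    (α : Fin N → ℝ) (T : ℕ) (I : ℕ → Fin K) : ℝ :=
  T * Finset.univ.sup' Finset.univ_nonempty (fun a => x a ⬝ᵥ α) -
    ∑ t ∈ Finset.Icc 1 T, x (I t) ⬝ᵥ α

/-- The confidence parameter `2R √(14 log (2K (1 + log₂ T) / δ)) + C`. -/
noncomputable def eliminatorBeta (R C δ : ℝ) (K T : ℕ) : ℝ :=
  2 * R * √(14 * Real.log (2 * K * (1 + Real.logb 2 T) / δ)) + C

/-! Once the active set `A` of a phase is fixed, the arms played are deterministic, because widths
and tie-breaking do not involve the rewards. Given the past before the phase, the noise part of the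
estimate of `⟨α, x a⟩` is therefore a sum of noises with fixed weights. The squares of these weights
sum to at most the squared width `‖x a‖²` in the norm of `V⁻¹`, so an ordinary Chernoff bound gives
a confidence radius without any factor depending on the dimension. Adding the bias, at most `C`
times the width, and a union bound over arms and completed phases gives error at most `β` times the
width everywhere, with probability at least `1 - δ`.

On that event the best arm is never eliminated, and an arm surviving a phase has gap at most `2β`
times the sum of its width and that of the best arm. Playing the widest arm makes every final width
at most the width of each arm when it was played. The squares of the latter, truncated at 1, sum to
at most `4 d log(1 + T/λ)`: telescoping log-determinants and Hadamard's inequality reduce the sum to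
`∑ log(1 + s_i/λ_i)`, which the definition of `d` controls. After `2^p` rounds the truncated widths
are thus `O(√(d log(1 + T/λ) / 2^p))`, and summing the resulting gaps over dyadic phases, with
Cauchy–Schwarz, produces `√(T log₂ T)`.

The carrying lemmas are `min_one_width_le`, `IsSubGaussianNoise.measure_lt_abs_sum_le`,
`measurableSet_activeArms_eq` and `cumulativeRegret_le`. -/

/-! ### Positive definite matrices: dual norms and determinants. -/

namespace Matrix.PosDef

variable {n : Type*} [Fintype n]

theorem dotProduct_mulVec_comm {V : Matrix n n ℝ} (hV : V.PosDef) (u v : n → ℝ) :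
    u ⬝ᵥ V *ᵥ v = v ⬝ᵥ V *ᵥ u := by
  have h : Vᵀ = V := by simpa using hV.isHermitian.eq
  rw [dotProduct_mulVec, ← mulVec_transpose, h, dotProduct_comm]

theorem quadForm_nonneg {V : Matrix n n ℝ} (hV : V.PosDef) (u : n → ℝ) : 0 ≤ u ⬝ᵥ V *ᵥ u := by
  simpa using hV.posSemidef.dotProduct_mulVec_nonneg u

theorem add_vecMulVec {V : Matrix n n ℝ} (hV : V.PosDef) (u : n → ℝ) :
    (V + vecMulVec u u).PosDef :=
  hV.add_posSemidef (by simpa using posSemidef_vecMulVec_self_star u)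

variable [DecidableEq n]

theorem inv_mulVec_mulVec {V : Matrix n n ℝ} (hV : V.PosDef) (u : n → ℝ) :
    V⁻¹ *ᵥ (V *ᵥ u) = u := by
  rw [mulVec_mulVec, nonsing_inv_mul _ ((isUnit_iff_isUnit_det V).1 hV.isUnit), one_mulVec]

theorem mulVec_inv_mulVec {V : Matrix n n ℝ} (hV : V.PosDef) (u : n → ℝ) :
    V *ᵥ (V⁻¹ *ᵥ u) = u := by
  rw [mulVec_mulVec, mul_nonsing_inv _ ((isUnit_iff_isUnit_det V).1 hV.isUnit), one_mulVec]

/-- The Cauchy–Schwarz inequality for the dual norms given by `V⁻¹` and `V`. -/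
theorem dotProduct_sq_le {V : Matrix n n ℝ} (hV : V.PosDef) (u v : n → ℝ) :
    (u ⬝ᵥ v) ^ 2 ≤ (u ⬝ᵥ V⁻¹ *ᵥ u) * (v ⬝ᵥ V *ᵥ v) := by
  -- The squared `V⁻¹`-norm of `u - t V v` is a nonnegative quadratic in `t`, so its discriminant is
  -- nonpositive.
  have key : ∀ t : ℝ, 0 ≤ (v ⬝ᵥ V *ᵥ v) * (t * t) + (-(2 * (u ⬝ᵥ v))) * t + u ⬝ᵥ V⁻¹ *ᵥ u := by
    intro t
    have h := hV.inv.quadForm_nonneg (u - t • V *ᵥ v)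
    have e1 : (V *ᵥ v) ⬝ᵥ V⁻¹ *ᵥ u = u ⬝ᵥ v := by
      rw [← hV.inv.dotProduct_mulVec_comm, hV.inv_mulVec_mulVec]
    have e2 : (V *ᵥ v) ⬝ᵥ v = v ⬝ᵥ V *ᵥ v := dotProduct_comm _ _
    simp only [mulVec_sub, mulVec_smul, hV.inv_mulVec_mulVec, sub_dotProduct, dotProduct_sub,
      smul_dotProduct, dotProduct_smul, smul_eq_mul, e1, e2] at h
    linarith
  have := discrim_le_zero key
  rw [discrim] at this
  nlinarith

/-- The inverse is antitone: a larger matrix has a smaller inverse quadratic form. -/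
theorem inv_quadForm_le {V W : Matrix n n ℝ} (hV : V.PosDef) (hW : W.PosDef)
    (h : ∀ v, v ⬝ᵥ V *ᵥ v ≤ v ⬝ᵥ W *ᵥ v) (u : n → ℝ) :
    u ⬝ᵥ W⁻¹ *ᵥ u ≤ u ⬝ᵥ V⁻¹ *ᵥ u := by
  have h1 := hV.dotProduct_sq_le u (W⁻¹ *ᵥ u)
  have h2 := h (W⁻¹ *ᵥ u)
  rw [hW.mulVec_inv_mulVec, dotProduct_comm (W⁻¹ *ᵥ u) u] at h2
  have h3 := hW.inv.quadForm_nonneg u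
  have h4 := hV.inv.quadForm_nonneg u
  rcases h3.eq_or_lt with h0 | h0
  · rw [← h0]; exact h4
  · have : (u ⬝ᵥ W⁻¹ *ᵥ u) ^ 2 ≤ (u ⬝ᵥ V⁻¹ *ᵥ u) * (u ⬝ᵥ W⁻¹ *ᵥ u) :=
      h1.trans (mul_le_mul_of_nonneg_left h2 h4)
    rw [sq] at this
    exact le_of_mul_le_mul_right this h0

/-- The matrix determinant lemma for a symmetric rank-one update. -/
theorem det_add_vecMulVec {V : Matrix n n ℝ} (hV : V.PosDef) (u : n → ℝ) :
    (V + vecMulVec u u).det = V.det * (1 + u ⬝ᵥ V⁻¹ *ᵥ u) := by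
  rw [vecMulVec_eq Unit, det_add_replicateCol_mul_replicateRow hV.det_pos.ne'.isUnit]
  congr 2
  rw [det_unique, Matrix.mul_assoc, ← replicateCol_mulVec]
  simp [Matrix.mul_apply, dotProduct]

/-- The logarithm of the determinant lies below its tangent at the identity. -/
theorem log_det_le_trace {V : Matrix n n ℝ} (hV : V.PosDef) :
    Real.log V.det ≤ V.trace - Fintype.card n := by
  have hd := hV.isHermitian.det_eq_prod_eigenvalues
  have ht := hV.isHermitian.trace_eq_sum_eigenvalues
  simp only [RCLike.ofReal_real_eq_id, id_eq] at hd ht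
  rw [hd, ht, Real.log_prod (fun i _ => (hV.eigenvalues_pos i).ne')]
  calc ∑ i, Real.log (hV.isHermitian.eigenvalues i)
      ≤ ∑ i, (hV.isHermitian.eigenvalues i - 1) :=
        Finset.sum_le_sum fun i _ => Real.log_le_sub_one_of_pos (hV.eigenvalues_pos i)
    _ = _ := by simp

/-- Hadamard's inequality. -/
theorem log_det_le_sum_log_diag {V : Matrix n n ℝ} (hV : V.PosDef) :
    Real.log V.det ≤ ∑ i, Real.log (V i i) := by
  have hpos : ∀ i, 0 < V i i := fun i => hV.diag_pos
  -- Rescaling to unit diagonal makes the trace equal to the dimension, so the tangent bound gives a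
  -- log-determinant at most 0.
  set s : n → ℝ := fun i => (√(V i i))⁻¹ with hs
  have hs0 : ∀ i, 0 < s i := fun i => inv_pos.2 (Real.sqrt_pos.2 (hpos i))
  have hS : IsUnit (diagonal s) := by
    rw [isUnit_iff_isUnit_det, det_diagonal]
    exact (Finset.prod_pos fun i _ => hs0 i).ne'.isUnit
  have hW : (diagonal s * V * star (diagonal s)).PosDef :=
    (IsUnit.posDef_star_right_conjugate_iff hS).2 hV
  have hstar : star (diagonal s) = diagonal s := by
    simp [star_eq_conjTranspose]
  rw [hstar] at hW
  have h := hW.log_det_le_trace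
  have htr : (diagonal s * V * diagonal s).trace = Fintype.card n := by
    have : ∀ i, (diagonal s * V * diagonal s) i i = 1 := by
      intro i
      rw [mul_diagonal, diagonal_mul]
      have := Real.mul_self_sqrt (hpos i).le
      have h0 := (Real.sqrt_pos.2 (hpos i)).ne'
      simp only [hs]
      field_simp
      rw [sq, this]
    simp [trace, this]
  have hslog : ∀ i, Real.log (s i) = -(Real.log (V i i) / 2) := by
    intro i
    rw [hs, Real.log_inv, Real.log_sqrt (hpos i).le]
  rw [htr, sub_self, det_mul, det_mul, det_diagonal, Real.log_mul, Real.log_mul,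
    Real.log_prod (fun i _ => (hs0 i).ne')] at h
  · simp only [hslog, Finset.sum_neg_distrib, ← Finset.sum_div] at h
    linarith
  · exact (Finset.prod_pos fun i _ => hs0 i).ne'
  · exact hV.det_pos.ne'
  · exact mul_ne_zero (Finset.prod_pos fun i _ => hs0 i).ne' hV.det_pos.ne'
  · exact (Finset.prod_pos fun i _ => hs0 i).ne'

end Matrix.PosDef

/-! ### Widths and the elliptical potential -/

section Potential

variable {K N : ℕ} {x : Fin K → Fin N → ℝ} {Lam : Matrix (Fin N) (Fin N) ℝ}
  {tie : ℕ → Finset (Fin K) → Fin K} {A : Finset (Fin K)} {t₀ : ℕ}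

theorem weightedNorm_nonneg (M : Matrix (Fin N) (Fin N) ℝ) (v : Fin N → ℝ) :
    0 ≤ weightedNorm M v := Real.sqrt_nonneg _

theorem Matrix.PosDef.weightedNorm_sq {M : Matrix (Fin N) (Fin N) ℝ} (hM : M.PosDef)
    (v : Fin N → ℝ) : weightedNorm M v ^ 2 = v ⬝ᵥ M *ᵥ v :=
  Real.sq_sqrt (hM.quadForm_nonneg v)

theorem phaseCov_succ (k : ℕ) :
    phaseCov x Lam tie A t₀ (k + 1) = phaseCov x Lam tie A t₀ k +
      Matrix.vecMulVec (x (phaseArm x Lam tie A t₀ k)) (x (phaseArm x Lam tie A t₀ k)) := rfl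

theorem phaseCov_posDef (hL : Lam.PosDef) (k : ℕ) : (phaseCov x Lam tie A t₀ k).PosDef := by
  induction k with
  | zero => exact hL
  | succ k ih => rw [phaseCov_succ]; exact ih.add_vecMulVec _

theorem phaseCov_mulVec (n : ℕ) (v : Fin N → ℝ) :
    phaseCov x Lam tie A t₀ n *ᵥ v =
      Lam *ᵥ v + ∑ k ∈ Finset.range n,
        (x (phaseArm x Lam tie A t₀ k) ⬝ᵥ v) • x (phaseArm x Lam tie A t₀ k) := by
  induction n with
  | zero => simp [phaseCov]
  | succ k ih =>
    rw [phaseCov_succ, Matrix.add_mulVec, ih, Finset.sum_range_succ, Matrix.vecMulVec_mulVec]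
    simp only [op_smul_eq_smul, add_assoc]

theorem phaseCov_quadForm (n : ℕ) (v : Fin N → ℝ) :
    v ⬝ᵥ phaseCov x Lam tie A t₀ n *ᵥ v =
      v ⬝ᵥ Lam *ᵥ v + ∑ k ∈ Finset.range n, (x (phaseArm x Lam tie A t₀ k) ⬝ᵥ v) ^ 2 := by
  rw [phaseCov_mulVec, dotProduct_add, dotProduct_sum]
  simp only [dotProduct_smul, smul_eq_mul, sq, dotProduct_comm v (x _)]

theorem phaseCov_diag (n : ℕ) (i : Fin N) :
    phaseCov x Lam tie A t₀ n i i =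
      Lam i i + ∑ k ∈ Finset.range n, x (phaseArm x Lam tie A t₀ k) i ^ 2 := by
  induction n with
  | zero => simp [phaseCov]
  | succ k ih =>
    rw [phaseCov_succ, Matrix.add_apply, ih, Finset.sum_range_succ, Matrix.vecMulVec_apply]
    ring

theorem weightedNorm_phaseCov_inv_antitone (hL : Lam.PosDef) (u : Fin N → ℝ) :
    Antitone fun n => weightedNorm (phaseCov x Lam tie A t₀ n)⁻¹ u := by
  refine antitone_nat_of_succ_le fun n => Real.sqrt_le_sqrt ?_
  refine (phaseCov_posDef hL n).inv_quadForm_le (phaseCov_posDef hL (n + 1)) (fun v => ?_) u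
  rw [phaseCov_quadForm, phaseCov_quadForm, Finset.sum_range_succ]
  nlinarith [sq_nonneg (x (phaseArm x Lam tie A t₀ n) ⬝ᵥ v)]

theorem widestArms_nonempty (hA : A.Nonempty) (V : Matrix (Fin N) (Fin N) ℝ) :
    (widestArms x A V).Nonempty := by
  obtain ⟨a, ha, hmax⟩ := A.exists_max_image (fun a => weightedNorm V⁻¹ (x a)) hA
  exact ⟨a, Finset.mem_filter.2 ⟨ha, hmax⟩⟩

theorem phaseArm_mem_widestArms (htie : ∀ t S, S.Nonempty → tie t S ∈ S) (hA : A.Nonempty)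
    (k : ℕ) : phaseArm x Lam tie A t₀ k ∈ widestArms x A (phaseCov x Lam tie A t₀ k) :=
  htie _ _ (widestArms_nonempty hA _)

/-- The determinant lemma, telescoped: each round multiplies the determinant by one plus the squared
width of the arm played. -/
theorem log_det_phaseCov (hL : Lam.PosDef) (n : ℕ) :
    Real.log (phaseCov x Lam tie A t₀ n).det = Real.log Lam.det + ∑ k ∈ Finset.range n,
      Real.log (1 + weightedNorm (phaseCov x Lam tie A t₀ k)⁻¹
        (x (phaseArm x Lam tie A t₀ k)) ^ 2) := by
  induction n with
  | zero => simp [phaseCov]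
  | succ k ih =>
    have hV := phaseCov_posDef (x := x) (tie := tie) (A := A) (t₀ := t₀) hL k
    rw [phaseCov_succ, hV.det_add_vecMulVec, ← hV.inv.weightedNorm_sq,
      Real.log_mul hV.det_pos.ne' (by positivity), ih, Finset.sum_range_succ, add_assoc]

/-- Truncation gives `u ≤ 1`, whence `u / 2 ≤ u / (1 + u) ≤ log (1 + u)`. Without it a width could
be too large for its logarithm, as `λ` may be small. -/
theorem min_one_sq_le_two_mul_log (w : ℝ) (hw : 0 ≤ w) :
    min 1 w ^ 2 ≤ 2 * Real.log (1 + w ^ 2) := by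
  have hm : 0 ≤ min 1 w := le_min zero_le_one hw
  have h1 : min 1 w ^ 2 ≤ 1 := pow_le_one₀ hm (min_le_left _ _)
  have h2 : min 1 w ^ 2 ≤ w ^ 2 := pow_le_pow_left₀ hm (min_le_right _ _) 2
  set u := min 1 w ^ 2
  have hu : 0 ≤ u := sq_nonneg _
  have h3 : Real.log (1 + u) ≤ Real.log (1 + w ^ 2) := Real.log_le_log (by positivity) (by linarith)
  have h4 := Real.one_sub_inv_le_log_of_pos (show 0 < 1 + u by positivity)
  have h5 : u / 2 ≤ 1 - (1 + u)⁻¹ := by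
    rw [show 1 - (1 + u)⁻¹ = u / (1 + u) by field_simp; ring]
    exact div_le_div_of_nonneg_left hu (by positivity) (by linarith)
  linarith

theorem sum_sq_le_one_of_norm_le {v : Fin N → ℝ} (hv : ‖WithLp.toLp 2 v‖ ≤ 1) :
    ∑ i, v i ^ 2 ≤ 1 := by
  have h := EuclideanSpace.real_norm_sq_eq (WithLp.toLp 2 v)
  simp only at h
  rw [← h]
  exact pow_le_one₀ (norm_nonneg _) hv

end Potential

/-! ### Effective dimension and the size of the widths. -/

section EffectiveDim

variable {N : ℕ} [NeZero N] {lam : Fin N → ℝ}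

theorem lt_mul_of_effectiveDim_le {T : ℕ} {i : Fin N} (hi : effectiveDim lam T ≤ i) :
    (T : ℝ) / Real.log (1 + T / lam 0) < i * lam i := by
  by_contra! h
  have : (i : ℕ) + 1 ≤ effectiveDim lam T :=
    Finset.le_sup (f := fun i : Fin N => (i : ℕ) + 1) (Finset.mem_filter.2 ⟨Finset.mem_univ i, h⟩)
  omega

/-- Each of the first `d` coordinates costs at most `log (1 + T/λ)`. On the others `log (1 + y) ≤ y`
bounds the total by `T / λ_{d+1}`, which the maximality of `d` makes at most `d log (1 + T/λ)`. -/
theorem sum_log_one_add_le_effectiveDim (hlam : Monotone lam) (hlam0 : 0 < lam 0) {T : ℕ}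
    (hT : 1 ≤ T) {s : Fin N → ℝ} (hs : ∀ i, 0 ≤ s i) (hsT : ∑ i, s i ≤ T) :
    ∑ i, Real.log (1 + s i / lam i) ≤
      2 * (effectiveDim lam T * Real.log (1 + T / lam 0)) := by
  set d := effectiveDim lam T with hd
  set ℓ := Real.log (1 + T / lam 0) with hℓ
  have hT0 : (0 : ℝ) < T := by exact_mod_cast hT
  have hℓ0 : 0 < ℓ := Real.log_pos (by have := div_pos hT0 hlam0; linarith)
  have hpos : ∀ i, 0 < lam i := fun i => hlam0.trans_le (hlam (Fin.zero_le i))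
  rw [← Finset.sum_filter_add_sum_filter_not Finset.univ (fun i : Fin N => (i : ℕ) < d), two_mul]
  refine add_le_add ?_ ?_
  · have hcard : (Finset.univ.filter fun i : Fin N => (i : ℕ) < d).card ≤ d := by
      calc _ = ((Finset.univ.filter fun i : Fin N => (i : ℕ) < d).map Fin.valEmbedding).card :=
            (Finset.card_map _).symm
        _ ≤ (Finset.range d).card := Finset.card_le_card fun j hj => by
            simp only [Finset.mem_map, Finset.mem_filter] at hj
            obtain ⟨i, hi, rfl⟩ := hj
            exact Finset.mem_range.2 hi.2
        _ = d := Finset.card_range d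
    calc _ ≤ ∑ i ∈ Finset.univ.filter (fun i : Fin N => (i : ℕ) < d), ℓ := by
          refine Finset.sum_le_sum fun i _ => ?_
          have h1 : s i ≤ T := (Finset.single_le_sum (fun j _ => hs j) (Finset.mem_univ i)).trans hsT
          have h2 : s i / lam i ≤ T / lam 0 := div_le_div₀ hT0.le h1 hlam0 (hlam (Fin.zero_le i))
          have h3 := div_nonneg (hs i) (hpos i).le
          exact Real.log_le_log (by linarith) (by linarith)
      _ ≤ d * ℓ := by
          rw [Finset.sum_const, nsmul_eq_mul]
          exact mul_le_mul_of_nonneg_right (by exact_mod_cast hcard) hℓ0.le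
  · rcases lt_or_ge d N with hdN | hdN
    · have hmax := lt_mul_of_effectiveDim_le (lam := lam) (T := T) (i := ⟨d, hdN⟩) le_rfl
      set L := lam ⟨d, hdN⟩ with hL
      have hLpos : 0 < L := hpos _
      rw [← hℓ, div_lt_iff₀ hℓ0] at hmax
      calc _ ≤ ∑ i ∈ Finset.univ.filter (fun i : Fin N => ¬ (i : ℕ) < d), s i / L := by
            refine Finset.sum_le_sum fun i hi => ?_
            have hdi : (⟨d, hdN⟩ : Fin N) ≤ i := by
              simpa [Fin.le_def] using (Finset.mem_filter.1 hi).2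
            have h3 := div_nonneg (hs i) (hpos i).le
            calc _ ≤ s i / lam i := by
                  have := Real.log_le_sub_one_of_pos (show 0 < 1 + s i / lam i by linarith)
                  linarith
              _ ≤ s i / L := div_le_div_of_nonneg_left (hs i) hLpos (hlam hdi)
        _ ≤ ∑ i, s i / L := Finset.sum_le_sum_of_subset_of_nonneg (Finset.filter_subset _ _)
            fun i _ _ => div_nonneg (hs i) hLpos.le
        _ ≤ T / L := by
            rw [← Finset.sum_div]
            exact div_le_div_of_nonneg_right hsT hLpos.le
        _ ≤ d * ℓ := by
            rw [div_le_iff₀ hLpos]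
            simp only at hmax
            nlinarith
    · rw [Finset.sum_eq_zero fun i hi => absurd (i.2.trans_le hdN) (Finset.mem_filter.1 hi).2]
      positivity

variable {K : ℕ} {x : Fin K → Fin N → ℝ}
  {tie : ℕ → Finset (Fin K) → Fin K} {A : Finset (Fin K)} {t₀ : ℕ}

/-- The elliptical potential bound in terms of the effective dimension. -/
theorem sum_min_one_width_sq_le (hlam : Monotone lam) (hlam0 : 0 < lam 0) {T : ℕ}
    (hT : 1 ≤ T) (hx : ∀ a, ‖WithLp.toLp 2 (x a)‖ ≤ 1) {n : ℕ} (hn : n ≤ T) :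
    ∑ k ∈ Finset.range n, min 1 (weightedNorm (phaseCov x (Matrix.diagonal lam) tie A t₀ k)⁻¹
      (x (phaseArm x (Matrix.diagonal lam) tie A t₀ k))) ^ 2 ≤
      4 * (effectiveDim lam T * Real.log (1 + T / lam 0)) := by
  have hpos : ∀ i, 0 < lam i := fun i => hlam0.trans_le (hlam (Fin.zero_le i))
  have hL : (Matrix.diagonal lam).PosDef := Matrix.PosDef.diagonal hpos
  set arm := phaseArm x (Matrix.diagonal lam) tie A t₀ with harm
  set s : Fin N → ℝ := fun i => ∑ k ∈ Finset.range n, x (arm k) i ^ 2 with hs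
  have hs0 : ∀ i, 0 ≤ s i := fun i => Finset.sum_nonneg fun k _ => sq_nonneg _
  have hsT : ∑ i, s i ≤ T := by
    rw [Finset.sum_comm]
    calc _ ≤ ∑ k ∈ Finset.range n, (1 : ℝ) :=
          Finset.sum_le_sum fun k _ => sum_sq_le_one_of_norm_le (hx _)
      _ ≤ T := by simpa using hn
  -- The growth of the log-determinant is bounded below by half the sum of truncated squared widths,
  -- and above, by Hadamard, by `∑ log (1 + s i / lam i)`.
  have h1 := log_det_phaseCov (x := x) (tie := tie) (A := A) (t₀ := t₀) hL n
  have h2 := (phaseCov_posDef (x := x) (tie := tie) (A := A) (t₀ := t₀) hL n).log_det_le_sum_log_diag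
  have h3 := sum_log_one_add_le_effectiveDim hlam hlam0 hT hs0 hsT
  have h4 : ∀ i, Real.log (phaseCov x (Matrix.diagonal lam) tie A t₀ n i i) =
      Real.log (lam i) + Real.log (1 + s i / lam i) := by
    intro i
    have : 0 ≤ s i / lam i := div_nonneg (hs0 i) (hpos i).le
    rw [phaseCov_diag, Matrix.diagonal_apply_eq, ← Real.log_mul (hpos i).ne' (by linarith)]
    congr 1
    have := (hpos i).ne'
    field_simp
    rfl
  rw [Finset.sum_congr rfl fun i _ => h4 i, Finset.sum_add_distrib] at h2
  rw [Matrix.det_diagonal, Real.log_prod fun i _ => (hpos i).ne'] at h1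
  have h5 := Finset.sum_le_sum fun k (_ : k ∈ Finset.range n) => min_one_sq_le_two_mul_log
    (weightedNorm (phaseCov x (Matrix.diagonal lam) tie A t₀ k)⁻¹ (x (arm k)))
    (weightedNorm_nonneg _ _)
  rw [← Finset.mul_sum] at h5
  linarith

/-- At the end of a phase of `n` rounds all the active arms have small width. -/
theorem min_one_width_le (hlam : Monotone lam) (hlam0 : 0 < lam 0) {T : ℕ}
    (hT : 1 ≤ T) (hx : ∀ a, ‖WithLp.toLp 2 (x a)‖ ≤ 1)
    (htie : ∀ t S, S.Nonempty → tie t S ∈ S) {n : ℕ} (hn0 : 0 < n) (hn : n ≤ T)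
    {a : Fin K} (ha : a ∈ A) :
    min 1 (weightedNorm (phaseCov x (Matrix.diagonal lam) tie A t₀ n)⁻¹ (x a)) ≤
      2 * √(effectiveDim lam T * Real.log (1 + T / lam 0)) / √n := by
  have hpos : ∀ i, 0 < lam i := fun i => hlam0.trans_le (hlam (Fin.zero_le i))
  have hL : (Matrix.diagonal lam).PosDef := Matrix.PosDef.diagonal hpos
  set D := effectiveDim lam T * Real.log (1 + T / lam 0) with hD
  set w := fun k => min 1 (weightedNorm (phaseCov x (Matrix.diagonal lam) tie A t₀ k)⁻¹
      (x (phaseArm x (Matrix.diagonal lam) tie A t₀ k))) with hw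
  set m := min 1 (weightedNorm (phaseCov x (Matrix.diagonal lam) tie A t₀ n)⁻¹ (x a)) with hm
  have hm0 : 0 ≤ m := le_min zero_le_one (weightedNorm_nonneg _ _)
  -- Widths decrease during the phase, and at round `k` the arm played is at least as wide as `a`.
  have hmw : ∀ k ∈ Finset.range n, m ≤ w k := fun k hk => by
    refine min_le_min le_rfl ?_
    refine (weightedNorm_phaseCov_inv_antitone hL (x a) (Finset.mem_range.1 hk).le).trans ?_
    exact (Finset.mem_filter.1 (phaseArm_mem_widestArms htie ⟨a, ha⟩ k)).2 a ha
  have h1 : n * m ^ 2 ≤ 4 * D := by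
    calc n * m ^ 2 = ∑ k ∈ Finset.range n, m ^ 2 := by simp
      _ ≤ ∑ k ∈ Finset.range n, w k ^ 2 :=
          Finset.sum_le_sum fun k hk => pow_le_pow_left₀ hm0 (hmw k hk) 2
      _ ≤ 4 * D := sum_min_one_width_sq_le hlam hlam0 hT hx hn
  have hn' : (0 : ℝ) < n := by exact_mod_cast hn0
  rw [le_div_iff₀ (Real.sqrt_pos.2 hn')]
  refine le_of_sq_le_sq ?_ (by positivity)
  have hD0 : 0 ≤ D := by nlinarith [sq_nonneg m]
  rw [mul_pow, mul_pow, Real.sq_sqrt hn'.le, Real.sq_sqrt hD0]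
  linarith

end EffectiveDim

/-! ### The estimation error of a phase -/

section Estimate

variable {K N : ℕ} {x : Fin K → Fin N → ℝ} {Lam : Matrix (Fin N) (Fin N) ℝ}
  {tie : ℕ → Finset (Fin K) → Fin K} {A : Finset (Fin K)} {t₀ : ℕ}

/-- The coefficient of the `k`-th reward of a phase of `n` rounds in the estimate of `⟨α, u⟩`. -/
noncomputable def estimateCoeff (x : Fin K → Fin N → ℝ) (Lam : Matrix (Fin N) (Fin N) ℝ)
    (tie : ℕ → Finset (Fin K) → Fin K) (A : Finset (Fin K)) (t₀ n : ℕ) (u : Fin N → ℝ)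
    (k : ℕ) : ℝ :=
  x (phaseArm x Lam tie A t₀ k) ⬝ᵥ (phaseCov x Lam tie A t₀ n)⁻¹ *ᵥ u

theorem phaseEstimate_dotProduct (hL : Lam.PosDef) (r : ℕ → ℝ) (n : ℕ) (u : Fin N → ℝ) :
    phaseEstimate x Lam tie r A t₀ n ⬝ᵥ u =
      ∑ k ∈ Finset.range n, estimateCoeff x Lam tie A t₀ n u k * r (t₀ + k) := by
  rw [phaseEstimate, dotProduct_comm, (phaseCov_posDef hL n).inv.dotProduct_mulVec_comm,
    sum_dotProduct]
  refine Finset.sum_congr rfl fun k _ => ?_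
  rw [smul_dotProduct, smul_eq_mul, mul_comm]
  rfl

/-- With `z = V⁻¹ u`, the squared width is `zᵀ V z`, which is `zᵀ Λ z` plus the sum of squared
coefficients. The width is thus a variance proxy for the noise part of the estimate. -/
theorem sum_estimateCoeff_sq_le (hL : Lam.PosDef) (n : ℕ) (u : Fin N → ℝ) :
    ∑ k ∈ Finset.range n, estimateCoeff x Lam tie A t₀ n u k ^ 2 ≤
      weightedNorm (phaseCov x Lam tie A t₀ n)⁻¹ u ^ 2 := by
  have hV := phaseCov_posDef (x := x) (tie := tie) (A := A) (t₀ := t₀) hL n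
  have h := phaseCov_quadForm (x := x) (Lam := Lam) (tie := tie) (A := A) (t₀ := t₀) n
    ((phaseCov x Lam tie A t₀ n)⁻¹ *ᵥ u)
  rw [hV.mulVec_inv_mulVec, dotProduct_comm _ u, ← hV.inv.weightedNorm_sq] at h
  rw [h]
  exact le_add_of_nonneg_left (hL.quadForm_nonneg _)

/-- The bias of the estimate is controlled by the penalty norm of the parameter. -/
theorem abs_dotProduct_bias_le (hL : Lam.PosDef) (n : ℕ) (u α : Fin N → ℝ) :
    |(Lam *ᵥ α) ⬝ᵥ (phaseCov x Lam tie A t₀ n)⁻¹ *ᵥ u| ≤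
      weightedNorm Lam α * weightedNorm (phaseCov x Lam tie A t₀ n)⁻¹ u := by
  have hV := phaseCov_posDef (x := x) (tie := tie) (A := A) (t₀ := t₀) hL n
  refine abs_le_of_sq_le_sq ?_ (mul_nonneg (weightedNorm_nonneg _ _) (weightedNorm_nonneg _ _))
  rw [mul_pow, hL.weightedNorm_sq, hV.inv.weightedNorm_sq]
  have h1 := hL.dotProduct_sq_le (Lam *ᵥ α) ((phaseCov x Lam tie A t₀ n)⁻¹ *ᵥ u)
  rw [hL.inv_mulVec_mulVec, dotProduct_comm _ α] at h1
  refine h1.trans (mul_le_mul_of_nonneg_left ?_ (hL.quadForm_nonneg _))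
  have h2 := phaseCov_quadForm (x := x) (Lam := Lam) (tie := tie) (A := A) (t₀ := t₀) n
    ((phaseCov x Lam tie A t₀ n)⁻¹ *ᵥ u)
  rw [hV.mulVec_inv_mulVec, dotProduct_comm _ u] at h2
  rw [h2]
  exact le_add_of_nonneg_right (Finset.sum_nonneg fun _ _ => sq_nonneg _)

/-- Writing `u ⬝ᵥ α` as the pairing of `V α` with `V⁻¹ u` and expanding `V`, the played-arm terms
cancel; noise and the bias from `Λ α` remain. -/
theorem abs_phaseEstimate_sub_le (hL : Lam.PosDef) {r e : ℕ → ℝ} {n : ℕ} {α : Fin N → ℝ}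
    (hr : ∀ k < n, r (t₀ + k) = x (phaseArm x Lam tie A t₀ k) ⬝ᵥ α + e (t₀ + k))
    (u : Fin N → ℝ) :
    |phaseEstimate x Lam tie r A t₀ n ⬝ᵥ u - u ⬝ᵥ α| ≤
      |∑ k ∈ Finset.range n, estimateCoeff x Lam tie A t₀ n u k * e (t₀ + k)| +
        weightedNorm Lam α * weightedNorm (phaseCov x Lam tie A t₀ n)⁻¹ u := by
  have hV := phaseCov_posDef (x := x) (tie := tie) (A := A) (t₀ := t₀) hL n
  have hkey : phaseEstimate x Lam tie r A t₀ n ⬝ᵥ u - u ⬝ᵥ α =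
      ∑ k ∈ Finset.range n, estimateCoeff x Lam tie A t₀ n u k * e (t₀ + k) -
        (Lam *ᵥ α) ⬝ᵥ (phaseCov x Lam tie A t₀ n)⁻¹ *ᵥ u := by
    have h1 : u ⬝ᵥ α = (phaseCov x Lam tie A t₀ n *ᵥ α) ⬝ᵥ
        (phaseCov x Lam tie A t₀ n)⁻¹ *ᵥ u := by
      rw [hV.inv.dotProduct_mulVec_comm, hV.inv_mulVec_mulVec]
    rw [h1, phaseCov_mulVec, phaseEstimate_dotProduct hL, add_dotProduct, sum_dotProduct,
      Finset.sum_congr rfl fun k hk => by rw [hr k (Finset.mem_range.1 hk), mul_add],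
      Finset.sum_add_distrib]
    simp only [smul_dotProduct, smul_eq_mul, estimateCoeff, mul_comm (x _ ⬝ᵥ α)]
    ring
  rw [hkey]
  exact (abs_sub _ _).trans (add_le_add_right (abs_dotProduct_bias_le hL n u α) _)

theorem phaseEstimate_congr {r r' : ℕ → ℝ} {n : ℕ} (h : ∀ k < n, r (t₀ + k) = r' (t₀ + k)) :
    phaseEstimate x Lam tie r A t₀ n = phaseEstimate x Lam tie r' A t₀ n := by
  rw [phaseEstimate, phaseEstimate,
    Finset.sum_congr rfl fun k hk => by rw [h k (Finset.mem_range.1 hk)]]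

end Estimate

/-! ### Concentration of conditionally sub-Gaussian noise -/

section Concentration

variable {Ω : Type*} {mΩ : MeasurableSpace Ω} {μ : Measure Ω}

/-- Working with `lintegral` allows any `m`-measurable `g`, with no integrability of the product to
check. The bound is an inequality between the measures with densities `f` and `c`, both restricted
to `m`. -/
theorem lintegral_mul_ofReal_le_of_condExp_le [IsFiniteMeasure μ] {m : MeasurableSpace Ω}
    (hm : m ≤ mΩ) {f : Ω → ℝ} (hf : Integrable f μ) (hf0 : 0 ≤ f) {c : ℝ} (hc : 0 ≤ c)
    (hfc : μ[f | m] ≤ᵐ[μ] fun _ => c) {g : Ω → ENNReal} (hg : Measurable[m] g) :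
    ∫⁻ ω, g ω * ENNReal.ofReal (f ω) ∂μ ≤ ENNReal.ofReal c * ∫⁻ ω, g ω ∂μ := by
  have hfm : AEMeasurable (fun ω => ENNReal.ofReal (f ω)) μ := hf.aemeasurable.ennreal_ofReal
  set ν := μ.withDensity fun ω => ENNReal.ofReal (f ω) with hν
  have hle : ν.trim hm ≤ ENNReal.ofReal c • μ.trim hm := by
    refine @Measure.le_intro Ω m _ _ fun s hs _ => ?_
    rw [Measure.smul_apply, smul_eq_mul, trim_measurableSet_eq hm hs, trim_measurableSet_eq hm hs,
      hν, withDensity_apply _ (hm s hs),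
      ← ofReal_integral_eq_lintegral_ofReal hf.integrableOn (ae_of_all _ hf0),
      ← setIntegral_condExp hm hf hs, ← ofReal_measureReal, ← ENNReal.ofReal_mul hc]
    refine ENNReal.ofReal_le_ofReal ?_
    calc ∫ ω in s, (μ[f | m]) ω ∂μ ≤ ∫ _ in s, c ∂μ :=
          setIntegral_mono_ae integrable_condExp.integrableOn (integrable_const c).integrableOn hfc
      _ = c * μ.real s := by simp [mul_comm]
  calc ∫⁻ ω, g ω * ENNReal.ofReal (f ω) ∂μ = ∫⁻ ω, g ω ∂ν := by
        rw [hν, lintegral_withDensity_eq_lintegral_mul₀ hfm (hg.mono hm le_rfl).aemeasurable]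
        simp [mul_comm]
    _ = ∫⁻ ω, g ω ∂(ν.trim hm) := (lintegral_trim hm hg).symm
    _ ≤ ∫⁻ ω, g ω ∂(ENNReal.ofReal c • μ.trim hm) := lintegral_mono' hle le_rfl
    _ = ENNReal.ofReal c * ∫⁻ ω, g ω ∂μ := by
        rw [lintegral_smul_measure, smul_eq_mul, lintegral_trim hm hg]

variable {ℱ : Filtration ℕ mΩ} {R : ℝ} {T : ℕ} {ε : ℕ → Ω → ℝ}

theorem IsSubGaussianNoise.measurable_sum (hε : IsSubGaussianNoise μ ℱ R T ε) {m n : ℕ}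
    (hT : m + n ≤ T) (c : ℕ → ℝ) :
    Measurable[ℱ (m + n)] fun ω => ∑ k ∈ Finset.range n, c k * ε (m + 1 + k) ω := by
  refine Finset.measurable_fun_sum _ fun k hk => ?_
  have hk' := Finset.mem_range.1 hk
  refine Measurable.const_mul ?_ _
  rw [show m + 1 + k = m + k + 1 by omega]
  exact (hε (m + k) (by omega)).1.mono (ℱ.mono (by omega)) le_rfl

/-- The last noise term is peeled off by conditioning on the past. The event `B`, known at time `m`,
will fix the active set and hence the weights. -/
theorem IsSubGaussianNoise.setLIntegral_exp_sum_le [IsFiniteMeasure μ]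
    (hε : IsSubGaussianNoise μ ℱ R T ε) {m n : ℕ} (hT : m + n ≤ T) (c : ℕ → ℝ) {B : Set Ω}
    (hB : MeasurableSet[ℱ m] B) (s : ℝ) :
    ∫⁻ ω in B, ENNReal.ofReal (Real.exp (s * ∑ k ∈ Finset.range n, c k * ε (m + 1 + k) ω)) ∂μ ≤
      ENNReal.ofReal (Real.exp (s ^ 2 * (R ^ 2 * ∑ k ∈ Finset.range n, c k ^ 2) / 2)) * μ B := by
  induction n with
  | zero => simp
  | succ n ih =>
    have hBm : MeasurableSet[ℱ (m + n)] B := ℱ.mono (Nat.le_add_right m n) _ hB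
    set g : Ω → ENNReal := B.indicator fun ω =>
      ENNReal.ofReal (Real.exp (s * ∑ k ∈ Finset.range n, c k * ε (m + 1 + k) ω)) with hg
    have hgm : Measurable[ℱ (m + n)] g := by
      refine Measurable.indicator ?_ hBm
      exact ((hε.measurable_sum (by omega) c).const_mul s).exp.ennreal_ofReal
    obtain ⟨hint, hcond⟩ := (hε (m + n) (by omega)).2 (s * c n)
    have h1 := lintegral_mul_ofReal_le_of_condExp_le (ℱ.le (m + n)) hint
      (fun ω => (Real.exp_pos _).le) (Real.exp_pos _).le hcond hgm
    have h2 : ∫⁻ ω, g ω ∂μ = ∫⁻ ω in B, ENNReal.ofReal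
        (Real.exp (s * ∑ k ∈ Finset.range n, c k * ε (m + 1 + k) ω)) ∂μ :=
      lintegral_indicator (ℱ.le m _ hB) _
    have h3 : ∫⁻ ω in B, ENNReal.ofReal
        (Real.exp (s * ∑ k ∈ Finset.range (n + 1), c k * ε (m + 1 + k) ω)) ∂μ =
        ∫⁻ ω, g ω * ENNReal.ofReal (Real.exp (s * c n * ε (m + n + 1) ω)) ∂μ := by
      rw [← lintegral_indicator (ℱ.le m _ hB)]
      refine lintegral_congr fun ω => ?_
      by_cases hω : ω ∈ B
      · simp only [hg, Set.indicator_of_mem hω]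
        rw [← ENNReal.ofReal_mul (Real.exp_pos _).le, ← Real.exp_add, Finset.sum_range_succ,
          show m + 1 + n = m + n + 1 by omega]
        ring_nf
      · simp [hg, Set.indicator_of_notMem hω]
    rw [h3]
    refine h1.trans ?_
    rw [h2]
    refine (mul_le_mul_right (ih (by omega)) _).trans (le_of_eq ?_)
    rw [← mul_assoc, ← ENNReal.ofReal_mul (Real.exp_pos _).le, ← Real.exp_add,
      Finset.sum_range_succ]
    ring_nf

theorem measure_inter_le_of_setLIntegral_exp_le {B : Set Ω} (hB : MeasurableSet B) {X : Ω → ℝ}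
    {s v : ℝ} (hs : 0 ≤ s)
    (h : ∫⁻ ω in B, ENNReal.ofReal (Real.exp (s * X ω)) ∂μ ≤
      ENNReal.ofReal (Real.exp (s ^ 2 * v / 2)) * μ B) (hX : Measurable X) (u : ℝ) :
    μ (B ∩ {ω | u ≤ X ω}) ≤ ENNReal.ofReal (Real.exp (s ^ 2 * v / 2 - s * u)) * μ B := by
  have hmeas : Measurable fun ω => ENNReal.ofReal (Real.exp (s * X ω)) :=
    (hX.const_mul s).exp.ennreal_ofReal
  have hmark := mul_meas_ge_le_lintegral (μ := μ.restrict B) hmeas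
    (ENNReal.ofReal (Real.exp (s * u)))
  have hsub : μ (B ∩ {ω | u ≤ X ω}) ≤ (μ.restrict B)
      {ω | ENNReal.ofReal (Real.exp (s * u)) ≤ ENNReal.ofReal (Real.exp (s * X ω))} := by
    rw [Measure.restrict_apply' hB, Set.inter_comm]
    refine measure_mono (Set.inter_subset_inter_left _ fun ω hω => ?_)
    exact ENNReal.ofReal_le_ofReal (Real.exp_le_exp.2 (mul_le_mul_of_nonneg_left hω hs))
  calc μ (B ∩ {ω | u ≤ X ω})
      = ENNReal.ofReal (Real.exp (-(s * u))) *
        (ENNReal.ofReal (Real.exp (s * u)) * μ (B ∩ {ω | u ≤ X ω})) := by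
        rw [← mul_assoc, ← ENNReal.ofReal_mul (Real.exp_pos _).le, ← Real.exp_add]
        simp
    _ ≤ ENNReal.ofReal (Real.exp (-(s * u))) *
        (ENNReal.ofReal (Real.exp (s ^ 2 * v / 2)) * μ B) := by
        exact mul_le_mul_right ((mul_le_mul_right hsub _).trans (hmark.trans h)) _
    _ = _ := by
        rw [← mul_assoc, ← ENNReal.ofReal_mul (Real.exp_pos _).le, ← Real.exp_add]
        ring_nf

theorem measure_inter_lt_le_of_forall_setLIntegral_exp_le [IsFiniteMeasure μ] {B : Set Ω}
    (hB : MeasurableSet B) {X : Ω → ℝ} (hX : Measurable X) {σ L : ℝ} (hσ : 0 ≤ σ) (hL : 0 ≤ L)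
    (h : ∀ s, ∫⁻ ω in B, ENNReal.ofReal (Real.exp (s * X ω)) ∂μ ≤
      ENNReal.ofReal (Real.exp (s ^ 2 * σ ^ 2 / 2)) * μ B) :
    μ (B ∩ {ω | σ * √(2 * L) < X ω}) ≤ ENNReal.ofReal (Real.exp (-L)) * μ B := by
  rcases hσ.eq_or_lt with rfl | hσ
  -- For `σ = 0` no optimal `s` exists; letting `s → ∞` in the Chernoff bound shows that `X > 0` is
  -- null on `B`.
  · have hzero : ∀ n : ℕ, μ (B ∩ {ω | 1 / ((n : ℝ) + 1) ≤ X ω}) = 0 := by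
      intro n
      have hn : 0 < 1 / ((n : ℝ) + 1) := by positivity
      have hb : ∀ s : ℕ, μ (B ∩ {ω | 1 / ((n : ℝ) + 1) ≤ X ω}) ≤
          ENNReal.ofReal (Real.exp (-((s : ℝ) * (1 / ((n : ℝ) + 1))))) * μ B := fun s => by
        simpa using measure_inter_le_of_setLIntegral_exp_le hB (Nat.cast_nonneg s) (h s) hX
          (1 / ((n : ℝ) + 1))
      have hlim : Filter.Tendsto (fun s : ℕ => ENNReal.ofReal
          (Real.exp (-((s : ℝ) * (1 / ((n : ℝ) + 1))))) * μ B) Filter.atTop (nhds 0) := by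
        rw [show (0 : ENNReal) = ENNReal.ofReal 0 * μ B by simp]
        refine ENNReal.Tendsto.mul_const (ENNReal.tendsto_ofReal ?_) (Or.inr (measure_ne_top _ _))
        refine Real.tendsto_exp_neg_atTop_nhds_zero.comp ?_
        exact tendsto_natCast_atTop_atTop.atTop_mul_const hn
      exact le_antisymm (ge_of_tendsto' hlim hb) zero_le
    have hsub : B ∩ {ω | 0 * √(2 * L) < X ω} ⊆ ⋃ n : ℕ, B ∩ {ω | 1 / ((n : ℝ) + 1) ≤ X ω} := by
      rintro ω ⟨hω, hx⟩
      simp only [zero_mul, Set.mem_ofPred_eq] at hx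
      obtain ⟨n, hn⟩ := exists_nat_one_div_lt hx
      exact Set.mem_iUnion.2 ⟨n, hω, hn.le⟩
    rw [measure_mono_null hsub (measure_iUnion_null hzero)]
    exact zero_le
  -- This `s` minimizes the Chernoff exponent, with minimum `-L`.
  · have hs : 0 ≤ √(2 * L) / σ := by positivity
    have h1 := measure_inter_le_of_setLIntegral_exp_le hB hs (h _) hX (σ * √(2 * L))
    have h2 : (√(2 * L) / σ) ^ 2 * σ ^ 2 / 2 - √(2 * L) / σ * (σ * √(2 * L)) = -L := by
      have := Real.sq_sqrt (show 0 ≤ 2 * L by positivity)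
      field_simp
      rw [this]
      ring
    rw [h2] at h1
    exact (measure_mono (Set.inter_subset_inter_right _
      fun ω (hω : σ * √(2 * L) < X ω) => (hω.le : σ * √(2 * L) ≤ X ω))).trans h1

/-- Concentration of a weighted sum of the noise, with weights that are known beforehand. -/
theorem IsSubGaussianNoise.measure_lt_sum_le [IsProbabilityMeasure μ]
    (hε : IsSubGaussianNoise μ ℱ R T ε) (hR : 0 ≤ R) {ι : Type*} [Fintype ι] {m n : ℕ}
    (hT : m + n ≤ T) {S : Ω → ι} (hS : ∀ i, MeasurableSet[ℱ m] {ω | S ω = i})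
    {c : ι → ℕ → ℝ} {w : ι → ℝ} (hw : ∀ i, 0 ≤ w i)
    (hc : ∀ i, ∑ k ∈ Finset.range n, c i k ^ 2 ≤ w i ^ 2) {L : ℝ} (hL : 0 ≤ L) :
    μ {ω | R * w (S ω) * √(2 * L) < ∑ k ∈ Finset.range n, c (S ω) k * ε (m + 1 + k) ω} ≤
      ENNReal.ofReal (Real.exp (-L)) := by
  have hSm : ∀ i, MeasurableSet {ω | S ω = i} := fun i => ℱ.le m _ (hS i)
  have hdisj : Pairwise (Function.onFun Disjoint fun i => {ω | S ω = i}) := by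
    intro i j hij
    refine Set.disjoint_left.2 fun ω h1 h2 => hij ?_
    exact h1.symm.trans h2
  have hsub : {ω | R * w (S ω) * √(2 * L) < ∑ k ∈ Finset.range n, c (S ω) k * ε (m + 1 + k) ω} ⊆
      ⋃ i, {ω | S ω = i} ∩ {ω | R * w i * √(2 * L) <
        ∑ k ∈ Finset.range n, c i k * ε (m + 1 + k) ω} :=
    fun ω hω => Set.mem_iUnion.2 ⟨S ω, rfl, hω⟩
  -- Each piece keeps the factor `μ {S = i}`. These sum to 1, so the random choice of weights costs
  -- no factor for the number of values of `S`.
  have hone : ∀ i, μ ({ω | S ω = i} ∩ {ω | R * w i * √(2 * L) <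
      ∑ k ∈ Finset.range n, c i k * ε (m + 1 + k) ω}) ≤
      ENNReal.ofReal (Real.exp (-L)) * μ {ω | S ω = i} := by
    intro i
    refine measure_inter_lt_le_of_forall_setLIntegral_exp_le (hSm i)
      ((hε.measurable_sum hT (c i)).mono (ℱ.le _) le_rfl) (mul_nonneg hR (hw i)) hL fun s => ?_
    refine (hε.setLIntegral_exp_sum_le hT (c i) (hS i) s).trans ?_
    gcongr
    rw [mul_pow]
    exact mul_le_mul_of_nonneg_left (hc i) (sq_nonneg R)
  calc _ ≤ ∑ i, μ ({ω | S ω = i} ∩ {ω | R * w i * √(2 * L) <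
        ∑ k ∈ Finset.range n, c i k * ε (m + 1 + k) ω}) :=
        (measure_mono hsub).trans (measure_iUnion_fintype_le _ _)
    _ ≤ ∑ i, ENNReal.ofReal (Real.exp (-L)) * μ {ω | S ω = i} :=
        Finset.sum_le_sum fun i _ => hone i
    _ = ENNReal.ofReal (Real.exp (-L)) * μ (⋃ i, {ω | S ω = i}) := by
        rw [← Finset.mul_sum, measure_iUnion hdisj hSm, tsum_fintype]
    _ ≤ ENNReal.ofReal (Real.exp (-L)) := mul_le_of_le_one_right zero_le prob_le_one

theorem IsSubGaussianNoise.measure_lt_abs_sum_le [IsProbabilityMeasure μ]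
    (hε : IsSubGaussianNoise μ ℱ R T ε) (hR : 0 ≤ R) {ι : Type*} [Fintype ι] {m n : ℕ}
    (hT : m + n ≤ T) {S : Ω → ι} (hS : ∀ i, MeasurableSet[ℱ m] {ω | S ω = i})
    {c : ι → ℕ → ℝ} {w : ι → ℝ} (hw : ∀ i, 0 ≤ w i)
    (hc : ∀ i, ∑ k ∈ Finset.range n, c i k ^ 2 ≤ w i ^ 2) {L : ℝ} (hL : 0 ≤ L) :
    μ {ω | R * w (S ω) * √(2 * L) < |∑ k ∈ Finset.range n, c (S ω) k * ε (m + 1 + k) ω|} ≤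
      2 * ENNReal.ofReal (Real.exp (-L)) := by
  have h1 := hε.measure_lt_sum_le hR hT hS hw hc hL
  have h2 := hε.measure_lt_sum_le hR hT hS (c := fun i k => -c i k) hw (by simpa using hc) hL
  rw [two_mul (ENNReal.ofReal _)]
  refine (measure_mono fun ω hω => ?_).trans ((measure_union_le _ _).trans (add_le_add h1 h2))
  rcases lt_abs.1 (show R * w (S ω) * √(2 * L) <
    |∑ k ∈ Finset.range n, c (S ω) k * ε (m + 1 + k) ω| from hω) with h | h
  · exact Or.inl h
  · exact Or.inr (by simpa using h)

end Concentration

/-! ### Regret over dyadic phases -/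

section Regret

theorem sum_Ico_natLog (g : ℕ → ℝ) (n : ℕ) :
    ∑ t ∈ Finset.Ico 1 (2 ^ n), g (Nat.log 2 t) = ∑ q ∈ Finset.range n, 2 ^ q * g q := by
  induction n with
  | zero => simp
  | succ n ih =>
    rw [← Finset.sum_Ico_consecutive _ Nat.one_le_two_pow
      (Nat.pow_le_pow_right two_pos n.le_succ), ih, Finset.sum_range_succ]
    congr 1
    rw [Finset.sum_congr rfl fun t ht => by
      rw [Nat.log_eq_of_pow_le_of_lt_pow (Finset.mem_Ico.1 ht).1 (Finset.mem_Ico.1 ht).2]]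
    rw [Finset.sum_const, Nat.card_Ico, pow_succ, mul_two, Nat.add_sub_cancel, nsmul_eq_mul]
    push_cast
    rfl

/-- Cauchy–Schwarz over the at most `log₂ T` terms, with a geometric sum below `T`. -/
theorem sum_sqrt_two_pow_le {T : ℕ} (hT : 1 ≤ T) :
    ∑ p ∈ Finset.range (Nat.log 2 T), √((2 : ℝ) ^ p) ≤ √(T * Real.logb 2 T) := by
  refine Real.le_sqrt_of_sq_le ?_
  have h1 := sq_sum_le_card_mul_sum_sq (s := Finset.range (Nat.log 2 T))
    (f := fun p => √((2 : ℝ) ^ p))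
  have h2 : ∑ p ∈ Finset.range (Nat.log 2 T), √((2 : ℝ) ^ p) ^ 2 ≤ T := by
    rw [Finset.sum_congr rfl fun p _ => Real.sq_sqrt (by positivity), geom_sum_eq (by norm_num)]
    have : (2 : ℝ) ^ Nat.log 2 T ≤ T := by exact_mod_cast Nat.pow_log_le_self 2 (by omega)
    linarith
  have h3 : (Nat.log 2 T : ℝ) ≤ Real.logb 2 T := by
    simpa using Real.natLog_le_logb T 2
  rw [Finset.card_range] at h1
  calc _ ≤ _ := h1
    _ ≤ Real.logb 2 T * T :=
        mul_le_mul h3 h2 (Finset.sum_nonneg fun _ _ => sq_nonneg _) ((Nat.cast_nonneg _).trans h3)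
    _ = _ := mul_comm _ _

theorem sum_dyadic_le {T : ℕ} (hT : 1 ≤ T) {Δ : ℕ → ℝ} {c : ℝ} (hc : 0 ≤ c) (h1 : Δ 1 ≤ 1)
    (h : ∀ p t, 2 ^ (p + 1) ≤ t → t < 2 ^ (p + 2) → t ≤ T → Δ t ≤ c / √((2 : ℝ) ^ p)) :
    ∑ t ∈ Finset.Icc 1 T, Δ t ≤ 1 + 2 * c * √(T * Real.logb 2 T) := by
  -- Round 1 is charged 1. The block of `2 ^ (p + 1)` rounds after it is controlled by the widths of
  -- the previous phase, of length `2 ^ p`, which is the source of the factor 2.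
  set g : ℕ → ℝ := fun q => Nat.casesOn q 1 fun p => c / √((2 : ℝ) ^ p) with hg
  have hg0 : ∀ q, 0 ≤ g q := by
    rintro (_ | p)
    · exact zero_le_one
    · simp only [hg]; positivity
  have hΔ : ∀ t ∈ Finset.Icc 1 T, Δ t ≤ g (Nat.log 2 t) := by
    intro t ht
    obtain ⟨ht1, htT⟩ := Finset.mem_Icc.1 ht
    have hlo := Nat.pow_log_le_self 2 (show t ≠ 0 by omega)
    have hhi := Nat.lt_pow_succ_log_self one_lt_two t
    rcases hq : Nat.log 2 t with _ | p
    · rw [hq] at hhi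
      obtain rfl : t = 1 := by simp at hhi; omega
      exact h1
    · rw [hq] at hlo hhi
      exact h p t hlo hhi htT
  have hsub : Finset.Icc 1 T ⊆ Finset.Ico 1 (2 ^ (Nat.log 2 T + 1)) := fun t ht => by
    obtain ⟨ht1, htT⟩ := Finset.mem_Icc.1 ht
    exact Finset.mem_Ico.2 ⟨ht1, htT.trans_lt (Nat.lt_pow_succ_log_self one_lt_two T)⟩
  have hterm : ∀ p : ℕ, (2 : ℝ) ^ (p + 1) * (c / √((2 : ℝ) ^ p)) = 2 * c * √((2 : ℝ) ^ p) := by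
    intro p
    have h0 : √((2 : ℝ) ^ p) ≠ 0 := by positivity
    have h2 := Real.sq_sqrt (show (0 : ℝ) ≤ 2 ^ p by positivity)
    field_simp
    rw [h2, pow_succ]
    ring
  calc ∑ t ∈ Finset.Icc 1 T, Δ t ≤ ∑ t ∈ Finset.Icc 1 T, g (Nat.log 2 t) := Finset.sum_le_sum hΔ
    _ ≤ ∑ t ∈ Finset.Ico 1 (2 ^ (Nat.log 2 T + 1)), g (Nat.log 2 t) :=
        Finset.sum_le_sum_of_subset_of_nonneg hsub fun t _ _ => hg0 _
    _ = 1 + 2 * c * ∑ p ∈ Finset.range (Nat.log 2 T), √((2 : ℝ) ^ p) := by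
        rw [sum_Ico_natLog, Finset.sum_range_succ', Finset.mul_sum, add_comm]
        congr 1
        · simp [hg]
        · exact Finset.sum_congr rfl fun p _ => hterm p
    _ ≤ _ := by
        gcongr
        exact sum_sqrt_two_pow_le hT

end Regret

/-! ### Elimination and regret when the confidence bounds hold. -/

section Eliminator

variable {K N : ℕ} {x : Fin K → Fin N → ℝ} {Lam : Matrix (Fin N) (Fin N) ℝ} {β : ℝ}
  {tie : ℕ → Finset (Fin K) → Fin K} {T : ℕ} {α : Fin N → ℝ}
  {I : ℕ → Fin K} {r e : ℕ → ℝ}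

theorem activeArms_dyadic_succ (p : ℕ) :
    activeArms x Lam β (fun j => 2 ^ (j - 1)) tie r (p + 2) =
      eliminate x β (activeArms x Lam β (fun j => 2 ^ (j - 1)) tie r (p + 1))
        (phaseCov x Lam tie (activeArms x Lam β (fun j => 2 ^ (j - 1)) tie r (p + 1))
          (2 ^ p) (2 ^ p))
        (phaseEstimate x Lam tie r (activeArms x Lam β (fun j => 2 ^ (j - 1)) tie r (p + 1))
          (2 ^ p) (2 ^ p)) := by
  have h : 2 ^ (p + 1) - 2 ^ p = 2 ^ p := by rw [pow_succ]; omega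
  rw [activeArms]
  simp only [Nat.add_sub_cancel, show p + 2 - 1 = p + 1 from rfl, h]

theorem IsSpectralEliminatorRun.arm_eq
    (hrun : IsSpectralEliminatorRun x Lam β (fun j => 2 ^ (j - 1)) tie T I r) {p k : ℕ}
    (hk : k < 2 ^ p) (hT : 2 ^ p + k ≤ T) :
    I (2 ^ p + k) = phaseArm x Lam tie
      (activeArms x Lam β (fun j => 2 ^ (j - 1)) tie r (p + 1)) (2 ^ p) k := by
  have h := hrun (p + 1) (by omega) (2 ^ p + k) (by simp) (by simp [pow_succ]; omega) hT
  simpa using h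

theorem IsSpectralEliminatorRun.reward_eq
    (hrun : IsSpectralEliminatorRun x Lam β (fun j => 2 ^ (j - 1)) tie T I r)
    (hr : ∀ t, 1 ≤ t → t ≤ T → r t = x (I t) ⬝ᵥ α + e t) {p k : ℕ}
    (hk : k < 2 ^ p) (hT : 2 ^ p + k ≤ T) :
    r (2 ^ p + k) = x (phaseArm x Lam tie
      (activeArms x Lam β (fun j => 2 ^ (j - 1)) tie r (p + 1)) (2 ^ p) k) ⬝ᵥ α +
        e (2 ^ p + k) := by
  rw [hr _ (Nat.one_le_two_pow.trans (Nat.le_add_right _ _)) hT, hrun.arm_eq hk hT]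

/-- An arm of largest expected reward is never eliminated while the confidence bounds hold. -/
theorem mem_activeArms_of_isMax {a : Fin K} (ha : ∀ b, x b ⬝ᵥ α ≤ x a ⬝ᵥ α)
    (hgood : ∀ p, 2 ^ (p + 1) ≤ T → ∀ b,
      |phaseEstimate x Lam tie r (activeArms x Lam β (fun j => 2 ^ (j - 1)) tie r (p + 1))
        (2 ^ p) (2 ^ p) ⬝ᵥ x b - x b ⬝ᵥ α| ≤ β * weightedNorm (phaseCov x Lam tie
          (activeArms x Lam β (fun j => 2 ^ (j - 1)) tie r (p + 1)) (2 ^ p) (2 ^ p))⁻¹ (x b))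
    {p : ℕ} (hp : 2 ^ p ≤ T) :
    a ∈ activeArms x Lam β (fun j => 2 ^ (j - 1)) tie r (p + 1) := by
  induction p with
  | zero => exact Finset.mem_univ a
  | succ p ih =>
    rw [activeArms_dyadic_succ]
    refine Finset.mem_filter.2 ⟨ih ((Nat.pow_le_pow_right two_pos p.le_succ).trans hp),
      fun b _ => ?_⟩
    have h1 := (abs_le.1 (hgood p hp a)).1
    have h2 := (abs_le.1 (hgood p hp b)).2
    linarith [ha b]

/-- On the event that all confidence bounds hold, the regret is small. -/
theorem cumulativeRegret_le [NeZero K] [NeZero N] {lam : Fin N → ℝ} (hT : 1 ≤ T)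
    (hlam : Monotone lam) (hlam0 : 0 < lam 0) (hx : ∀ a, ‖WithLp.toLp 2 (x a)‖ ≤ 1)
    (hα : ∀ a, x a ⬝ᵥ α ∈ Set.Icc (0 : ℝ) 1) (hβ : 0 ≤ β)
    (htie : ∀ t S, S.Nonempty → tie t S ∈ S)
    (hrun : IsSpectralEliminatorRun x (Matrix.diagonal lam) β (fun j => 2 ^ (j - 1)) tie T I r)
    (hgood : ∀ p, 2 ^ (p + 1) ≤ T → ∀ b,
      |phaseEstimate x (Matrix.diagonal lam) tie r
        (activeArms x (Matrix.diagonal lam) β (fun j => 2 ^ (j - 1)) tie r (p + 1))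
        (2 ^ p) (2 ^ p) ⬝ᵥ x b - x b ⬝ᵥ α| ≤
      β * weightedNorm (phaseCov x (Matrix.diagonal lam) tie
        (activeArms x (Matrix.diagonal lam) β (fun j => 2 ^ (j - 1)) tie r (p + 1))
        (2 ^ p) (2 ^ p))⁻¹ (x b)) :
    cumulativeRegret x α T I ≤ 2 + 16 * (β + 1 / 2) *
      √(effectiveDim lam T * T * Real.logb 2 T * Real.log (1 + T / lam 0)) := by
  obtain ⟨s, -, hs⟩ := Finset.exists_mem_eq_sup' (Finset.univ_nonempty (α := Fin K))
    fun a => x a ⬝ᵥ α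
  have hmax : ∀ b, x b ⬝ᵥ α ≤ x s ⬝ᵥ α := fun b =>
    hs ▸ Finset.le_sup' (fun a => x a ⬝ᵥ α) (Finset.mem_univ b)
  have hgap : ∀ b, x s ⬝ᵥ α - x b ⬝ᵥ α ≤ 1 := fun b => by linarith [(hα s).2, (hα b).1]
  set D := effectiveDim lam T * Real.log (1 + T / lam 0) with hD
  have hreg : cumulativeRegret x α T I =
      ∑ t ∈ Finset.Icc 1 T, (x s ⬝ᵥ α - x (I t) ⬝ᵥ α) := by
    rw [cumulativeRegret, hs, Finset.sum_sub_distrib]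
    simp
  have hphase : ∀ p t, 2 ^ (p + 1) ≤ t → t < 2 ^ (p + 2) → t ≤ T →
      x s ⬝ᵥ α - x (I t) ⬝ᵥ α ≤ 8 * (β + 1 / 2) * √D / √((2 : ℝ) ^ p) := by
    intro p t ht1 ht2 htT
    have hpT : 2 ^ (p + 1) ≤ T := ht1.trans htT
    have hpT' : 2 ^ p ≤ T := (Nat.pow_le_pow_right two_pos p.le_succ).trans hpT
    have hs1 := mem_activeArms_of_isMax hmax hgood hpT'
    have hs2 := mem_activeArms_of_isMax hmax hgood hpT
    -- The arm played in phase `p + 2` survived phase `p + 1`, so the elimination test compares it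
    -- with the best arm.
    have hmem : I t ∈ activeArms x (Matrix.diagonal lam) β (fun j => 2 ^ (j - 1)) tie r
        (p + 2) := by
      obtain ⟨k, rfl⟩ := Nat.exists_eq_add_of_le ht1
      rw [hrun.arm_eq (p := p + 1) (by rw [pow_succ 2 (p + 1)] at ht2; omega) htT]
      exact (Finset.mem_filter.1 (phaseArm_mem_widestArms htie ⟨s, hs2⟩ k)).1
    rw [activeArms_dyadic_succ] at hmem
    obtain ⟨hmem1, hmem2⟩ := Finset.mem_filter.1 hmem
    have hw1 := min_one_width_le (t₀ := 2 ^ p) hlam hlam0 hT hx htie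
      (Nat.two_pow_pos p) hpT' hmem1
    have hw2 := min_one_width_le (t₀ := 2 ^ p) hlam hlam0 hT hx htie
      (Nat.two_pow_pos p) hpT' hs1
    have he := hmem2 s hs1
    have h1 := (abs_le.1 (hgood p hpT (I t))).2
    have h2 := (abs_le.1 (hgood p hpT s)).1
    rw [← hD, Nat.cast_pow, Nat.cast_ofNat] at hw1 hw2
    set M := 2 * √D / √((2 : ℝ) ^ p) with hM
    have hM0 : 0 ≤ M := by positivity
    have hgoal : 8 * (β + 1 / 2) * √D / √((2 : ℝ) ^ p) = 4 * (β + 1 / 2) * M := by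
      rw [hM]; ring
    rw [hgoal]
    -- If a truncation is active then `1 ≤ M`, and the trivial gap bound 1 is absorbed by the `1 /
    -- 2` in `β + 1 / 2`. Otherwise the two estimation errors and the elimination test give a gap at
    -- most `4 * β * M`.
    rcases min_le_iff.1 hw1 with h | hw1
    · nlinarith [hgap (I t), mul_nonneg hβ hM0]
    rcases min_le_iff.1 hw2 with h | hw2
    · nlinarith [hgap (I t), mul_nonneg hβ hM0]
    have h3 := mul_le_mul_of_nonneg_left hw1 hβ
    have h4 := mul_le_mul_of_nonneg_left hw2 hβ
    linarith
  have hsum := sum_dyadic_le hT (by positivity) (hgap (I 1)) hphase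
  rw [hreg]
  refine hsum.trans ?_
  have hD0 : 0 ≤ D := by
    have : 0 ≤ (T : ℝ) / lam 0 := by positivity
    exact mul_nonneg (Nat.cast_nonneg _) (Real.log_nonneg (by linarith))
  have hsqrt : √(effectiveDim lam T * T * Real.logb 2 T * Real.log (1 + T / lam 0)) =
      √D * √(T * Real.logb 2 T) := by
    rw [← Real.sqrt_mul hD0, hD]
    ring_nf
  rw [hsqrt]
  linarith

end Eliminator

/-! ### The confidence bounds hold with high probability -/

section HighProbability

variable {Ω : Type*} {mΩ : MeasurableSpace Ω} {μ : Measure Ω} {ℱ : Filtration ℕ mΩ}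
  {K N : ℕ} {x : Fin K → Fin N → ℝ} {Lam : Matrix (Fin N) (Fin N) ℝ} {β R : ℝ}
  {tie : ℕ → Finset (Fin K) → Fin K} {T : ℕ} {α : Fin N → ℝ}
  {I : ℕ → Ω → Fin K} {r ε : ℕ → Ω → ℝ}

theorem measurableSet_eliminate_eq {m : MeasurableSpace Ω} {est : Ω → Fin N → ℝ}
    (hest : ∀ a, Measurable fun ω => est ω ⬝ᵥ x a) (A B : Finset (Fin K))
    (V : Matrix (Fin N) (Fin N) ℝ) : MeasurableSet {ω | eliminate x β A V (est ω) = B} := by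
  have hset : {ω | eliminate x β A V (est ω) = B} =
      {ω | ∀ a, (a ∈ A ∧ ∀ a' ∈ A, est ω ⬝ᵥ x a' - β * weightedNorm V⁻¹ (x a') ≤
        est ω ⬝ᵥ x a + β * weightedNorm V⁻¹ (x a)) ↔ a ∈ B} := by
    ext ω
    simp [eliminate, Finset.ext_iff]
  rw [hset]
  refine measurableSet_setOfPred.2 (Measurable.forall fun a => Measurable.iff ?_ measurable_const)
  refine Measurable.and measurable_const (Measurable.forall fun a' => ?_)
  refine Measurable.imp measurable_const (measurableSet_setOfPred.1 ?_)
  exact measurableSet_le ((hest a').sub_const _) ((hest a).add_const _)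

/-- The active arms of a phase are determined by what happened before the phase. -/
theorem measurableSet_activeArms_eq (hε : IsSubGaussianNoise μ ℱ R T ε) (hL : Lam.PosDef)
    (hr : ∀ t ω, 1 ≤ t → t ≤ T → r t ω = x (I t ω) ⬝ᵥ α + ε t ω)
    (hrun : ∀ ω, IsSpectralEliminatorRun x Lam β (fun j => 2 ^ (j - 1)) tie T
      (fun t => I t ω) fun t => r t ω) {p : ℕ} (hp : 2 ^ p ≤ T) (B : Finset (Fin K)) :
    MeasurableSet[ℱ (2 ^ p - 1)]
      {ω | activeArms x Lam β (fun j => 2 ^ (j - 1)) tie (fun t => r t ω) (p + 1) = B} := by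
  induction p generalizing B with
  | zero => exact MeasurableSet.const (Finset.univ = B)
  | succ p ih =>
    have h2p : 1 ≤ 2 ^ p := Nat.one_le_two_pow
    have hsucc : 2 ^ (p + 1) = 2 ^ p + 2 ^ p := by rw [pow_succ]; ring
    -- These are the phase's rewards had the active set been `A`. The arms are then deterministic,
    -- so measurability reduces to that of the noise on each event fixing the active set.
    set ρ : Finset (Fin K) → Ω → ℕ → ℝ := fun A ω t =>
      x (phaseArm x Lam tie A (2 ^ p) (t - 2 ^ p)) ⬝ᵥ α + ε t ω with hρ
    have hset : {ω | activeArms x Lam β (fun j => 2 ^ (j - 1)) tie (fun t => r t ω)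
          (p + 1 + 1) = B} =
        ⋃ A, {ω | activeArms x Lam β (fun j => 2 ^ (j - 1)) tie (fun t => r t ω) (p + 1) = A} ∩
          {ω | eliminate x β A (phaseCov x Lam tie A (2 ^ p) (2 ^ p))
            (phaseEstimate x Lam tie (ρ A ω) A (2 ^ p) (2 ^ p)) = B} := by
      have hkey : ∀ ω, phaseEstimate x Lam tie (fun t => r t ω)
          (activeArms x Lam β (fun j => 2 ^ (j - 1)) tie (fun t => r t ω) (p + 1))
          (2 ^ p) (2 ^ p) = phaseEstimate x Lam tie
          (ρ (activeArms x Lam β (fun j => 2 ^ (j - 1)) tie (fun t => r t ω) (p + 1)) ω)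
          (activeArms x Lam β (fun j => 2 ^ (j - 1)) tie (fun t => r t ω) (p + 1))
          (2 ^ p) (2 ^ p) := fun ω => by
        refine phaseEstimate_congr fun k hk => ?_
        rw [(hrun ω).reward_eq (e := fun t => ε t ω) (fun t h1 h2 => hr t ω h1 h2) hk (by omega)]
        simp [hρ]
      ext ω
      simp only [Set.mem_iUnion, Set.mem_inter_iff, Set.mem_ofPred_eq, exists_eq_left']
      rw [activeArms_dyadic_succ, hkey]
    rw [hset]
    refine MeasurableSet.iUnion fun A => MeasurableSet.inter ?_ ?_
    · exact ℱ.mono (by omega) _ (ih (by omega) A)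
    · refine measurableSet_eliminate_eq (fun a => ?_) A B _
      simp only [phaseEstimate_dotProduct hL, hρ]
      refine Finset.measurable_fun_sum _ fun k hk => Measurable.const_mul ?_ _
      have hk' := Finset.mem_range.1 hk
      refine Measurable.const_add ?_ _
      rw [show 2 ^ p + k = 2 ^ p + k - 1 + 1 by omega]
      exact (hε (2 ^ p + k - 1) (by omega)).1.mono (ℱ.mono (by omega)) le_rfl

/-- The event that some noise term exceeds its confidence bound has small probability. -/
theorem measure_exists_lt_noise_le [IsProbabilityMeasure μ] (hT : 1 ≤ T) (hR : 0 ≤ R)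
    (hε : IsSubGaussianNoise μ ℱ R T ε) (hL : Lam.PosDef)
    (hr : ∀ t ω, 1 ≤ t → t ≤ T → r t ω = x (I t ω) ⬝ᵥ α + ε t ω)
    (hrun : ∀ ω, IsSpectralEliminatorRun x Lam β (fun j => 2 ^ (j - 1)) tie T
      (fun t => I t ω) fun t => r t ω) {L : ℝ} (hL0 : 0 ≤ L)
    {A : ℕ → Ω → Finset (Fin K)} (hA : A = fun p ω =>
      activeArms x Lam β (fun j => 2 ^ (j - 1)) tie (fun t => r t ω) (p + 1)) :
    μ.real {ω | ∃ p, 2 ^ (p + 1) ≤ T ∧ ∃ a,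
      R * weightedNorm (phaseCov x Lam tie (A p ω) (2 ^ p) (2 ^ p))⁻¹ (x a) * √(2 * L) <
        |∑ k ∈ Finset.range (2 ^ p),
          estimateCoeff x Lam tie (A p ω) (2 ^ p) (2 ^ p) (x a) k * ε (2 ^ p + k) ω|} ≤
      Nat.log 2 T * K * (2 * Real.exp (-L)) := by
  set E : ℕ → Fin K → Set Ω := fun p a => {ω |
      R * weightedNorm (phaseCov x Lam tie (A p ω) (2 ^ p) (2 ^ p))⁻¹ (x a) * √(2 * L) <
        |∑ k ∈ Finset.range (2 ^ p),
          estimateCoeff x Lam tie (A p ω) (2 ^ p) (2 ^ p) (x a) k * ε (2 ^ p + k) ω|} with hE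
  have hone : ∀ p, 2 ^ (p + 1) ≤ T → ∀ a, μ.real (E p a) ≤ 2 * Real.exp (-L) := by
    intro p hp a
    have h2p : 1 ≤ 2 ^ p := Nat.one_le_two_pow
    have hsucc : 2 ^ (p + 1) = 2 ^ p + 2 ^ p := by rw [pow_succ]; ring
    -- The phase starts at round `2 ^ p`, so its active set is known at time `2 ^ p - 1`.
    have h := hε.measure_lt_abs_sum_le hR (m := 2 ^ p - 1) (n := 2 ^ p) (by omega) (S := A p)
      (by rw [hA]; exact fun B => measurableSet_activeArms_eq hε hL hr hrun (by omega) B)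
      (c := fun B => estimateCoeff x Lam tie B (2 ^ p) (2 ^ p) (x a))
      (w := fun B => weightedNorm (phaseCov x Lam tie B (2 ^ p) (2 ^ p))⁻¹ (x a))
      (fun B => weightedNorm_nonneg _ _) (fun B => sum_estimateCoeff_sq_le hL _ _) hL0
    rw [Nat.sub_add_cancel h2p] at h
    refine ENNReal.toReal_le_of_le_ofReal (by positivity) (h.trans (le_of_eq ?_))
    rw [ENNReal.ofReal_mul zero_le_two, ENNReal.ofReal_ofNat]
  have hsub : {ω | ∃ p, 2 ^ (p + 1) ≤ T ∧ ∃ a, ω ∈ E p a} ⊆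
      ⋃ p ∈ Finset.range (Nat.log 2 T), ⋃ a ∈ Finset.univ, E p a := by
    rintro ω ⟨p, hp, a, ha⟩
    have : p + 1 ≤ Nat.log 2 T := Nat.le_log_of_pow_le one_lt_two hp
    simp only [Set.mem_iUnion, Finset.mem_range, Finset.mem_univ, exists_prop, true_and]
    exact ⟨p, this, a, ha⟩
  have hpT : ∀ p ∈ Finset.range (Nat.log 2 T), 2 ^ (p + 1) ≤ T := fun p hp =>
    (Nat.pow_le_pow_right two_pos (Finset.mem_range.1 hp)).trans (Nat.pow_log_le_self 2 (by omega))
  calc _ ≤ μ.real (⋃ p ∈ Finset.range (Nat.log 2 T), ⋃ a ∈ Finset.univ, E p a) :=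
        measureReal_mono hsub (measure_ne_top _ _)
    _ ≤ ∑ p ∈ Finset.range (Nat.log 2 T), μ.real (⋃ a ∈ Finset.univ, E p a) :=
        measureReal_biUnion_finset_le _ _
    _ ≤ ∑ p ∈ Finset.range (Nat.log 2 T), ∑ a : Fin K, μ.real (E p a) :=
        Finset.sum_le_sum fun p _ => measureReal_biUnion_finset_le _ _
    _ ≤ ∑ p ∈ Finset.range (Nat.log 2 T), ∑ a : Fin K, 2 * Real.exp (-L) :=
        Finset.sum_le_sum fun p hp => Finset.sum_le_sum fun a _ => hone p (hpT p hp) a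
    _ = _ := by simp [mul_assoc]

end HighProbability

/-- **Regret of SpectralEliminator.** -/
theorem mainTheorem3 {Ω : Type*} {mΩ : MeasurableSpace Ω} (μ : Measure Ω)
    [IsProbabilityMeasure μ] (ℱ : Filtration ℕ mΩ)
    {K N : ℕ} [NeZero K] [NeZero N] (T : ℕ) (hT : 1 ≤ T)
    -- the eigenvalues of the penalty matrix, the smallest of which is `lam 0`
    (lam : Fin N → ℝ) (hlam : Monotone lam) (hlam0 : 0 < lam 0)
    -- the feature vectors of the arms and the unknown parameter
    (x : Fin K → Fin N → ℝ) (hx : ∀ a, ‖WithLp.toLp 2 (x a)‖ ≤ 1)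
    (α : Fin N → ℝ) (hα : ∀ a, x a ⬝ᵥ α ∈ Set.Icc (0 : ℝ) 1)
    (C : ℝ) (hC : weightedNorm (Matrix.diagonal lam) α ≤ C)
    -- the noise
    (R : ℝ) (hR : 0 ≤ R) (ε : ℕ → Ω → ℝ) (hε : IsSubGaussianNoise μ ℱ R T ε)
    (δ : ℝ) (hδ : 0 < δ)
    -- a rule for breaking ties in the maximization of the width
    (tie : ℕ → Finset (Fin K) → Fin K) (htie : ∀ t S, S.Nonempty → tie t S ∈ S)
    -- the arms played and the rewards observed
    (I : ℕ → Ω → Fin K) (r : ℕ → Ω → ℝ)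
    (hr : ∀ t ω, 1 ≤ t → t ≤ T → r t ω = x (I t ω) ⬝ᵥ α + ε t ω)
    (hrun : ∀ ω, IsSpectralEliminatorRun x (Matrix.diagonal lam) (eliminatorBeta R C δ K T)
      (fun j => 2 ^ (j - 1)) tie T (fun t => I t ω) (fun t => r t ω)) :
    1 - δ ≤ μ.real {ω | cumulativeRegret x α T (fun t => I t ω) ≤
      2 + 16 * (2 * R * √(14 * Real.log (2 * K * (1 + Real.logb 2 T) / δ)) + C + 1 / 2) *
        √(effectiveDim lam T * T * Real.logb 2 T * Real.log (1 + T / lam 0))} := by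
  rcases le_or_gt 1 δ with hδ1 | hδ1
  · exact (sub_nonpos.2 hδ1).trans measureReal_nonneg
  have hL : (Matrix.diagonal lam).PosDef :=
    Matrix.PosDef.diagonal fun i => hlam0.trans_le (hlam (Fin.zero_le i))
  have hK : (1 : ℝ) ≤ K := by exact_mod_cast NeZero.one_le (n := K)
  have hlogb : (Nat.log 2 T : ℝ) ≤ Real.logb 2 T := by simpa using Real.natLog_le_logb T 2
  have hlogb0 : 0 ≤ Real.logb 2 T := (Nat.cast_nonneg _).trans hlogb
  have hC0 : 0 ≤ C := (weightedNorm_nonneg _ _).trans hC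
  set Q := 2 * K * (1 + Real.logb 2 T) with hQ
  have hQ1 : 1 ≤ Q := by nlinarith
  have hQδ : 1 ≤ Q / δ := by rw [le_div_iff₀ hδ]; linarith
  set ℓ := Real.log (Q / δ) with hℓ
  have hℓ0 : 0 ≤ ℓ := Real.log_nonneg hQδ
  set β := eliminatorBeta R C δ K T with hβ
  have hβ_eq : β = 2 * R * √(14 * ℓ) + C := rfl
  have hβ0 : 0 ≤ β := by rw [hβ_eq]; positivity
  rw [← hβ_eq]
  have hbad := measure_exists_lt_noise_le hT hR hε hL hr hrun hℓ0 rfl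
  set bad := {ω | ∃ p, 2 ^ (p + 1) ≤ T ∧ ∃ a,
      R * weightedNorm (phaseCov x (Matrix.diagonal lam) tie
        (activeArms x (Matrix.diagonal lam) β (fun j => 2 ^ (j - 1)) tie (fun t => r t ω) (p + 1))
        (2 ^ p) (2 ^ p))⁻¹ (x a) * √(2 * ℓ) <
        |∑ k ∈ Finset.range (2 ^ p), estimateCoeff x (Matrix.diagonal lam) tie
          (activeArms x (Matrix.diagonal lam) β (fun j => 2 ^ (j - 1)) tie (fun t => r t ω)
            (p + 1)) (2 ^ p) (2 ^ p) (x a) k * ε (2 ^ p + k) ω|} with hbad_def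
  -- The factors of `Q` pay for the two signs, the `K` arms and the at most `log₂ T` phases in the
  -- union bound.
  have hbadδ : μ.real bad ≤ δ := by
    refine hbad.trans ?_
    have hexp : Real.exp (-ℓ) = δ / Q := by
      rw [Real.exp_neg, hℓ, Real.exp_log (by linarith), inv_div]
    rw [hexp, ← mul_div_assoc, ← mul_div_assoc, div_le_iff₀ (by linarith), hQ]
    have : (Nat.log 2 T : ℝ) * (K * δ) ≤ (1 + Real.logb 2 T) * (K * δ) :=
      mul_le_mul_of_nonneg_right (by linarith) (by positivity)
    linarith
  set good := {ω | cumulativeRegret x α T (fun t => I t ω) ≤ 2 + 16 * (β + 1 / 2) *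
    √(effectiveDim lam T * T * Real.logb 2 T * Real.log (1 + T / lam 0))} with hgood_def
  have hcover : Set.univ ⊆ good ∪ bad := by
    intro ω _
    by_cases hω : ω ∈ bad
    · exact Or.inr hω
    refine Or.inl (cumulativeRegret_le hT hlam hlam0 hx hα hβ0 htie (hrun ω) fun p hp b => ?_)
    have hnoise := not_lt.1 fun h => hω ⟨p, hp, b, h⟩
    have h2p : 2 ^ (p + 1) = 2 ^ p + 2 ^ p := by rw [pow_succ]; ring
    have hest := abs_phaseEstimate_sub_le hL (x := x) (r := fun t => r t ω) (e := fun t => ε t ω)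
      (t₀ := 2 ^ p) (n := 2 ^ p) (fun k hk =>
      (hrun ω).reward_eq (p := p) (fun t h1 h2 => hr t ω h1 h2) hk (by omega)) (x b)
    refine hest.trans ((add_le_add_left hnoise _).trans ?_)
    set w := weightedNorm (phaseCov x (Matrix.diagonal lam) tie
      (activeArms x (Matrix.diagonal lam) β (fun j => 2 ^ (j - 1)) tie (fun t => r t ω) (p + 1))
      (2 ^ p) (2 ^ p))⁻¹ (x b) with hw
    have hw0 : 0 ≤ w := weightedNorm_nonneg _ _
    -- The argument needs only `R * √(2 * ℓ) + C`; the larger constant in `β` is slack here.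
    have hs : √(2 * ℓ) ≤ 2 * √(14 * ℓ) := by
      have : √(2 * ℓ) ≤ √(14 * ℓ) := Real.sqrt_le_sqrt (by linarith)
      linarith [Real.sqrt_nonneg (14 * ℓ)]
    have h1 := mul_le_mul_of_nonneg_left hs (mul_nonneg hR hw0)
    have h2 := mul_le_mul_of_nonneg_right hC hw0
    rw [hβ_eq]
    linarith
  have h1 : (1 : ℝ) ≤ μ.real good + μ.real bad := by
    calc (1 : ℝ) = μ.real Set.univ := by simp
      _ ≤ μ.real (good ∪ bad) := measureReal_mono hcover
      _ ≤ _ := measureReal_union_le _ _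
  linarith
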